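/- Let $\mathbf{C}$ be the category whose objects are the finite metric spaces and whose morphisms are the non-expansive surjections, i.e. the surjective maps $f:(M,d)\to(M',d')$ with $d'(f(x),f(y))\le d(x,y)$ for all $x,y\in M$; write $\hom(\mathcal{M},\mathcal{N})$ for its hom-sets. For a finite metric space $\mathcal{M}$, the dual small Ramsey degree $t^\partial(\mathcal{M})$ is the least positive integer $t$ with the following property, and $t^\partial(\mathcal{M})=\infty$ if there is no such integer: for every $k\in\mathbb{N}$ and every finite metric space $\mathcal{B}$ with $\hom(\mathcal{B},\mathcal{M})\neq\varnothing$ there is a finite metric space $\mathcal{D}$ with $\hom(\mathcal{D},\mathcal{B})\neq\varnothing$ such that for every colouring $\chi:\hom(\mathcal{D},\mathcal{M})\to\{0,\dots,k-1\}$ there is $w\in\hom(\mathcal{D},\mathcal{B})$ with $$|\{\chi(f\circ w) : f\in\hom(\mathcal{B},\mathcal{M})\}|\le t.$$ (Equivalently, $t^\partial(\mathcal{M})$ is the small Ramsey degree of $\mathcal{M}$ in the opposite category $\mathbf{C}^{\mathrm{op}}$.) Theorem. The category $\mathbf{C}$ has finite dual small Ramsey degrees, that is, $t^\partial(\mathcal{M})<\infty$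 for every finite metric space $\mathcal{M}$. Moreover, $t^\partial(\mathcal{M})=|M|!$ for every finite metric space $\mathcal{M}=(M,d)$. -/

import Mathlib

open CategoryTheory

universe v u

namespace RamseyDegree

section General

variable {C : Type u} [Category.{v} C]

/-- The partition arrow `Z ⟶ (Y)^X_{k,t}`: for every colouring `χ : hom(X, Z) → k` there is
`w ∈ hom(Y, Z)` such that `χ` takes at most `t` values on `w · hom(X, Y) = {w · f : f ∈ hom(X, Y)}`.
The composite `w · f` is `f ≫ w` in Mathlib's notation. -/
def Arrow (Z Y X : C) (k t : ℕ) : Prop :=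
  ∀ χ : (X ⟶ Z) → Fin k, ∃ w : Y ⟶ Z,
    (χ '' (Set.range fun f : X ⟶ Y => f ≫ w)).ncard ≤ t

/-- For every number `k` of colours and every `Y` with `X → Y` there is a `Z` with `Y → Z` such that
`Z ⟶ (Y)^X_{k,t}`. (The arrow is only considered for objects with `X → Y → Z`.) -/
def IsSmallRamseyBound (X : C) (t : ℕ) : Prop :=
  ∀ (k : ℕ) (Y : C), Nonempty (X ⟶ Y) → ∃ Z : C, Nonempty (Y ⟶ Z) ∧ Arrow Z Y X k t

/-- The small Ramsey degree of `X`: the least positive integer `t` with the property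
`IsSmallRamseyBound X t`, and `⊤` if there is none. -/
noncomputable def smallRamseyDegree (X : C) : ℕ∞ :=
  sInf {n : ℕ∞ | ∃ t : ℕ, 0 < t ∧ IsSmallRamseyBound X t ∧ n = (t : ℕ∞)}

/-- The dual small Ramsey degree of `X`: the small Ramsey degree in the opposite category. -/
noncomputable def dualSmallRamseyDegree (X : C) : ℕ∞ :=
  smallRamseyDegree (Opposite.op X)

variable (C)

/-- `C` has finite small Ramsey degrees. -/
def HasFiniteSmallRamseyDegrees : Prop :=
  ∀ X : C, smallRamseyDegree X < ⊤

/-- `C` has finite dual small Ramsey degrees. -/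
def HasFiniteDualSmallRamseyDegrees : Prop :=
  HasFiniteSmallRamseyDegrees Cᵒᵖ

end General

/-- Finite metric spaces, the objects of the category of finite metric spaces and
non-expansive surjections. -/
structure FinMet : Type (u + 1) where
  carrier : Type u
  [metric : MetricSpace carrier]
  [fin : Finite carrier]

attribute [instance] FinMet.metric FinMet.fin

namespace FinMet

/-- Non-expansive surjections. -/
@[ext]
structure Hom (M N : FinMet.{u}) : Type u where
  toFun : M.carrier → N.carrier
  nonexpansive : ∀ x y, dist (toFun x) (toFun y) ≤ dist x y
  surjective : Function.Surjective toFun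

instance : Category.{u} FinMet.{u} where
  Hom M N := Hom M N
  id M := ⟨id, fun _ _ => le_rfl, Function.surjective_id⟩
  comp f g := ⟨g.toFun ∘ f.toFun,
    fun x y => (g.nonexpansive _ _).trans (f.nonexpansive x y),
    g.surjective.comp f.surjective⟩

end FinMet

end RamseyDegree

/-!
# Dual small Ramsey degrees of finite metric spaces

On an equilateral space with sufficiently large distances every surjection is non-expansive. Both
bounds use such spaces, which turns the statement into one about surjections between finite sets.

*Upper bound.* Let `D` be equilateral on `N` points. Every surjection between finite ordered sets is
uniquely a rigid surjection (the minima of the fibres are in increasing order) followed by a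
permutation. Colouring a rigid surjection from `D` to `M` by the tuple of the colours of its
compositions with the `|M|!` permutations of `M`, the finite dual Ramsey theorem yields a rigid
`w` from `D` to `B` such that the colour of `f ∘ w` depends only on the permutation belonging to
`f`. The values of the colouring on `hom(B, M) ∘ w` therefore number at most `|M|!`, whatever
subset of the surjections `hom(B, M)` is.

*Lower bound.* Let `B` be equilateral on the points of `M`, so that every permutation of `M` is a
morphism from `B` to `M`. The permutations act freely on the surjections from any `D` to `M`; after
the choice of a representative of each orbit, a surjection is coloured by the permutation that
carries the representative to it. All `|M|!` colours then occur on `hom(B, M) ∘ w`, for every `w`.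

The finite dual Ramsey theorem is the case of the empty alphabet in the Graham–Rothschild theorem
on parameter words (`DualRamsey.grahamRothschild`), which is derived from the Hales–Jewett theorem
by induction on the number `k` of parameters, for all alphabets at once. A word with `k + 1`
parameters is a prefix of constants, its first parameter, and a word with `k` parameters over the
alphabet enlarged by that first parameter. The induction hypothesis is used to make the colour
depend on the prefix only (`DualRamsey.exists_colour_eq_of_pre_eq`); Hales–Jewett and the pigeonhole
principle make colourings of prefixes constant (`DualRamsey.exists_pre_colouring_const`).
-/

/-! ### Growth words and substitution -/

namespace DualRamsey

/-- `IsGrowthWord a b l`: the word `l` over `ℕ` uses the constants `0, …, a - 1` and the parameters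
`a, …, b - 1`, every parameter occurs, and the parameters first occur in increasing order. This is
a `(b - a)`-parameter word over an alphabet with `a` letters; for `a = 0` it is a rigid surjection
from `{0, …, l.length - 1}` onto `{0, …, b - 1}`. A parameter that has occurred is treated as a
constant from then on. -/
inductive IsGrowthWord : ℕ → ℕ → List ℕ → Prop
  | nil (a : ℕ) : IsGrowthWord a a []
  | old {a b x : ℕ} {l : List ℕ} : x < a → IsGrowthWord a b l → IsGrowthWord a b (x :: l)
  | new {a b : ℕ} {l : List ℕ} : IsGrowthWord (a + 1) b l → IsGrowthWord a b (a :: l)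

/-- The letter map that fixes the constants `0, …, a - 1` and sends the parameter `a + j` to the
`j`-th letter of `f`, so that `w.map (fill a f)` is the substitution of `f` into `w`. Parameters
beyond the length of `f` go to `a`, which is not a constant. -/
def fill (a : ℕ) (f : List ℕ) (s : ℕ) : ℕ :=
  if s < a then s else f.getD (s - a) a

/-- The part of a word before its first letter outside `0, …, a - 1`. -/
def pre (a : ℕ) (l : List ℕ) : List ℕ := l.takeWhile (· < a)

theorem fill_of_lt {a s : ℕ} (f : List ℕ) (h : s < a) : fill a f s = s := if_pos h

theorem fill_add {a : ℕ} (f : List ℕ) (j : ℕ) : fill a f (a + j) = f.getD j a := by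
  simp [fill]

namespace IsGrowthWord

theorem le {a b : ℕ} {l : List ℕ} (h : IsGrowthWord a b l) : a ≤ b := by
  induction h <;> omega

theorem lt_of_mem {a b x : ℕ} {l : List ℕ} (h : IsGrowthWord a b l) (hx : x ∈ l) : x < b := by
  induction h with
  | nil => simp at hx
  | old hy h ih =>
    rcases List.mem_cons.1 hx with rfl | hx
    · exact hy.trans_le h.le
    · exact ih hx
  | new h ih =>
    rcases List.mem_cons.1 hx with rfl | hx
    · exact h.le
    · exact ih hx

theorem mem {a b y : ℕ} {l : List ℕ} (h : IsGrowthWord a b l) (hay : a ≤ y) (hyb : y < b) :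
    y ∈ l := by
  induction h with
  | nil => omega
  | old _ _ ih => exact List.mem_cons_of_mem _ (ih hay hyb)
  | @new a _ _ _ ih =>
    rcases hay.eq_or_lt with rfl | hlt
    · exact List.mem_cons_self
    · exact List.mem_cons_of_mem _ (ih hlt hyb)

theorem append {a b c : ℕ} {l l' : List ℕ} (h : IsGrowthWord a b l) (h' : IsGrowthWord b c l') :
    IsGrowthWord a c (l ++ l') := by
  induction h with
  | nil => exact h'
  | old hy _ ih => exact .old hy (ih h')
  | new _ ih => exact .new (ih h')

theorem of_forall_lt {a : ℕ} {l : List ℕ} (h : ∀ x ∈ l, x < a) : IsGrowthWord a a l := by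
  induction l with
  | nil => exact .nil a
  | cons x l ih =>
    exact .old (h x List.mem_cons_self) (ih fun y hy => h y (List.mem_cons_of_mem _ hy))

theorem of_forall_lt_succ {a : ℕ} {l : List ℕ} (h : ∀ x ∈ l, x < a + 1) (ha : a ∈ l) :
    IsGrowthWord a (a + 1) l := by
  induction l with
  | nil => simp at ha
  | cons x l ih =>
    have hl : ∀ y ∈ l, y < a + 1 := fun y hy => h y (List.mem_cons_of_mem _ hy)
    rcases (Nat.lt_succ_iff.1 (h x List.mem_cons_self)).eq_or_lt with rfl | hx
    · exact .new (of_forall_lt hl)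
    · refine .old hx (ih hl ?_)
      rcases List.mem_cons.1 ha with rfl | ha
      · exact absurd hx (lt_irrefl _)
      · exact ha

/-- A word split as `f₁ ++ f₂` is substituted into the tail of a word whose head has already used
up the parameters filled by `f₁`; the letters of `f₁` are then constants of the result. -/
theorem map_fill_append {a c d e b : ℕ} {w f₁ f₂ : List ℕ} (hw : IsGrowthWord e b w)
    (he : e = a + f₁.length) (hb : b = e + f₂.length) (hf₂ : IsGrowthWord d c f₂)
    (hf₁ : ∀ x ∈ f₁, x < d) (had : a ≤ d) :
    IsGrowthWord d c (w.map (fill a (f₁ ++ f₂))) := by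
  induction hw generalizing f₁ f₂ d with
  | nil =>
    have : f₂ = [] := List.eq_nil_of_length_eq_zero (by omega)
    subst this
    exact hf₂
  | @old e b x l hx _ ih =>
    refine .old ?_ (ih he hb hf₂ hf₁ had)
    by_cases hxa : x < a
    · rw [fill_of_lt _ hxa]; omega
    · obtain ⟨j, rfl⟩ := Nat.exists_eq_add_of_le (not_lt.1 hxa)
      have hj : j < f₁.length := by omega
      rw [fill_add, List.getD_append _ _ _ _ hj, List.getD_eq_getElem _ _ hj]
      exact hf₁ _ (List.getElem_mem hj)
  | @new e b l h ih =>
    have hle := h.le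
    rcases f₂ with _ | ⟨y, g⟩
    · simp at hb; omega
    have key : fill a (f₁ ++ y :: g) e = y := by
      rw [he, fill_add]; simp [List.getD_eq_getElem?_getD]
    have hsplit : f₁ ++ y :: g = (f₁ ++ [y]) ++ g := by simp
    have hlen : e + 1 = a + (f₁ ++ [y]).length := by simp; omega
    have hlen' : b = e + 1 + g.length := by simp at hb; omega
    rw [List.map_cons, key, hsplit]
    cases hf₂ with
    | old hy hg =>
      refine .old hy (ih hlen hlen' hg ?_ had)
      intro x hx
      rcases List.mem_append.1 hx with hx | hx
      · exact hf₁ x hx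
      · rw [List.mem_singleton.1 hx]; exact hy
    | new hg =>
      refine .new (ih hlen hlen' hg ?_ (by omega))
      intro x hx
      rcases List.mem_append.1 hx with hx | hx
      · exact (hf₁ x hx).trans (Nat.lt_succ_self _)
      · rw [List.mem_singleton.1 hx]; exact Nat.lt_succ_self _

/-- Growth words are closed under substitution. -/
theorem map_fill {a c : ℕ} {w f : List ℕ} (hw : IsGrowthWord a (a + f.length) w)
    (hf : IsGrowthWord a c f) : IsGrowthWord a c (w.map (fill a f)) :=
  map_fill_append (f₁ := []) hw rfl rfl hf (by simp) le_rfl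

theorem map_succ_of_le {a c d : ℕ} {f : List ℕ} (h : IsGrowthWord c d f) (hac : a ≤ c) :
    IsGrowthWord (c + 1) (d + 1) (f.map fun x => if x < a then x else x + 1) := by
  induction h with
  | nil => exact .nil _
  | old hx _ ih =>
    refine .old ?_ (ih hac)
    dsimp only
    split_ifs <;> omega
  | new _ ih =>
    rw [List.map_cons, if_neg (by omega)]
    exact .new (ih (by omega))

theorem flatMap_finRange {m : ℕ} (a : ℕ) (B : Fin m → List ℕ)
    (h : ∀ j : Fin m, IsGrowthWord (a + j) (a + j + 1) (B j)) :
    IsGrowthWord a (a + m) ((List.finRange m).flatMap B) := by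
  induction m generalizing a with
  | zero => simpa using IsGrowthWord.nil a
  | succ m ih =>
    rw [List.finRange_succ, List.flatMap_cons, List.flatMap_map]
    refine (h 0).append ?_
    have := ih (a + 1) (fun j => B j.succ) fun j => by
      have := h j.succ
      rwa [Fin.val_succ, show a + (j.val + 1) = a + 1 + j.val by omega] at this
    rwa [show a + 1 + m = a + (m + 1) by omega] at this

end IsGrowthWord

theorem fill_map_fill {a s : ℕ} {u : List ℕ} (g : List ℕ) (hs : s < a + u.length) :
    fill a (u.map (fill a g)) s = fill a g (fill a u s) := by
  by_cases h : s < a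
  · rw [fill_of_lt _ h, fill_of_lt _ h, fill_of_lt _ h]
  · obtain ⟨j, rfl⟩ := Nat.exists_eq_add_of_le (not_lt.1 h)
    have hj : j < u.length := by omega
    rw [fill_add, fill_add, List.getD_eq_getElem _ _ (by simpa using hj),
      List.getD_eq_getElem _ _ hj, List.getElem_map]

/-- Substitution is associative. -/
theorem map_fill_map_fill {a : ℕ} {w u : List ℕ} (hw : IsGrowthWord a (a + u.length) w)
    (g : List ℕ) : w.map (fill a (u.map (fill a g))) = (w.map (fill a u)).map (fill a g) := by
  rw [List.map_map]
  exact List.map_congr_left fun s hs => fill_map_fill g (hw.lt_of_mem hs)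

theorem exists_le_mem_map_fill {a m : ℕ} {w f : List ℕ} (hw : IsGrowthWord a (a + m) w)
    (hm : f.length = m) (hf : ∃ x ∈ f, a ≤ x) : ∃ x ∈ w.map (fill a f), a ≤ x := by
  obtain ⟨x, hx, hax⟩ := hf
  obtain ⟨j, hj, rfl⟩ := List.mem_iff_getElem.1 hx
  refine ⟨_, List.mem_map_of_mem (hw.mem (y := a + j) (by omega) (by omega)), ?_⟩
  rwa [fill_add, List.getD_eq_getElem _ _ hj]

theorem pre_cons_of_lt {a x : ℕ} (l : List ℕ) (h : x < a) : pre a (x :: l) = x :: pre a l := by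
  simp [pre, h]

theorem pre_cons_of_le {a x : ℕ} (l : List ℕ) (h : a ≤ x) : pre a (x :: l) = [] := by
  simp [pre, h]

theorem pre_append_of_forall {a : ℕ} {l : List ℕ} (l' : List ℕ) (h : ∀ x ∈ l, x < a) :
    pre a (l ++ l') = l ++ pre a l' :=
  List.takeWhile_append_of_pos (by simpa using h)

theorem pre_append_of_exists {a : ℕ} {l : List ℕ} (l' : List ℕ) (h : ∃ x ∈ l, a ≤ x) :
    pre a (l ++ l') = pre a l := by
  induction l with
  | nil => simp at h
  | cons y l ih =>
    rw [List.cons_append]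
    by_cases hy : y < a
    · rw [pre_cons_of_lt _ hy, pre_cons_of_lt _ hy, ih]
      obtain ⟨x, hx, hax⟩ := h
      rcases List.mem_cons.1 hx with rfl | hx
      · omega
      · exact ⟨x, hx, hax⟩
    · rw [pre_cons_of_le _ (not_lt.1 hy), pre_cons_of_le _ (not_lt.1 hy)]

theorem getD_pre_of_lt {a j : ℕ} {h : List ℕ} (hj : j < (pre a h).length) :
    (pre a h).getD j a = h.getD j a ∧ h.getD j a < a := by
  induction h generalizing j with
  | nil => simp [pre] at hj
  | cons x l ih =>
    by_cases hx : x < a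
    · rw [pre_cons_of_lt _ hx] at hj ⊢
      rcases j with _ | j
      · exact ⟨rfl, hx⟩
      · simpa using ih (by simpa using hj)
    · rw [pre_cons_of_le _ (not_lt.1 hx)] at hj
      simp at hj

theorem le_getD_length_pre (a : ℕ) (h : List ℕ) : a ≤ h.getD (pre a h).length a := by
  induction h with
  | nil => simp
  | cons x l ih =>
    by_cases hx : x < a
    · rw [pre_cons_of_lt _ hx]; simpa using ih
    · rw [pre_cons_of_le _ (not_lt.1 hx)]; simpa using hx

/-- The form of `pre_map_fill_pre` for a tail `V` of a word in which the parameters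
`a, …, a + j - 1` have already occurred, all of them filled by letters of the prefix of `h`. -/
theorem pre_map_fill_pre_aux {a e b j : ℕ} {V : List ℕ} (hV : IsGrowthWord e b V) (he : e = a + j)
    (h : List ℕ) (hj : j ≤ (pre a h).length) :
    pre a (V.map (fill a h)) = pre a (V.map (fill a (pre a h))) := by
  induction hV generalizing j with
  | nil => rfl
  | @old e b x l hx _ ih =>
    have hxe : fill a h x = fill a (pre a h) x ∧ fill a h x < a := by
      by_cases hxa : x < a
      · rw [fill_of_lt _ hxa, fill_of_lt _ hxa]; exact ⟨rfl, hxa⟩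
      · obtain ⟨i, rfl⟩ := Nat.exists_eq_add_of_le (not_lt.1 hxa)
        have := getD_pre_of_lt (a := a) (h := h) (j := i) (by omega)
        rw [fill_add, fill_add]
        exact ⟨this.1.symm, this.2⟩
    rw [List.map_cons, List.map_cons, ← hxe.1, pre_cons_of_lt _ hxe.2, pre_cons_of_lt _ hxe.2,
      ih he hj]
  | @new e b l _ ih =>
    subst he
    rw [List.map_cons, List.map_cons, fill_add, fill_add]
    rcases hj.eq_or_lt with rfl | hlt
    · rw [pre_cons_of_le _ (le_getD_length_pre a h), pre_cons_of_le _ (by simp)]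
    · obtain ⟨h1, h2⟩ := getD_pre_of_lt hlt
      rw [h1, pre_cons_of_lt _ h2, pre_cons_of_lt _ h2, ih (j := j + 1) (by omega) hlt]

/-- Because the parameters of `V` first occur in order, the prefix of a substitution into `V`
depends only on the prefix of the substituted word. -/
theorem pre_map_fill_pre {a b : ℕ} {V : List ℕ} (hV : IsGrowthWord a b V) (h : List ℕ) :
    pre a (V.map (fill a h)) = pre a (V.map (fill a (pre a h))) :=
  pre_map_fill_pre_aux (j := 0) hV rfl h (Nat.zero_le _)

/-! ### The Graham–Rothschild theorem -/

/-- The Graham–Rothschild property for `k`-parameter words over an alphabet with `a` letters: for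
every finite set of colours and every `m` there is a length `n` such that every colouring admits an
`m`-parameter word of length `n` into which all `k`-parameter words of length `m` substitute with
the same colour. Colourings are defined on all lists; only their values on the relevant words
matter. -/
def GrahamRothschild (a k : ℕ) : Prop :=
  ∀ (κ : Type) [Finite κ] (m : ℕ), ∃ n, ∀ χ : List ℕ → κ, ∃ w, w.length = n ∧
    IsGrowthWord a (a + m) w ∧ ∃ c, ∀ f : List ℕ, f.length = m → IsGrowthWord a (a + k) f →
      χ (w.map (fill a f)) = c

/-- The case without parameters. A combinatorial line in the `m`-th power of the alphabet is an
`m`-parameter word once its coordinates are listed in `m` blocks, one for each factor: the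
parameters then first occur in increasing order. -/
theorem grahamRothschild_zero (a : ℕ) : GrahamRothschild a 0 := by
  intro κ _ m
  obtain ⟨ι, _, hι⟩ := Combinatorics.Line.exists_mono_in_high_dimension (Fin m → Fin a) κ
  refine ⟨m * Fintype.card ι, fun χ => ?_⟩
  obtain ⟨l, c, hc⟩ := hι fun x =>
    χ ((List.finRange m).flatMap fun j => Finset.univ.toList.map fun i => (x i j : ℕ))
  let B : Fin m → List ℕ := fun j =>
    Finset.univ.toList.map fun i => (l.idxFun i).elim (a + j) fun v => v j
  refine ⟨(List.finRange m).flatMap B, ?_, ?_, c, ?_⟩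
  · simp [B, List.length_flatMap]
  · refine IsGrowthWord.flatMap_finRange a B fun j => .of_forall_lt_succ ?_ ?_
    · intro x hx
      obtain ⟨i, -, rfl⟩ := List.mem_map.1 hx
      rcases l.idxFun i with _ | v
      · exact Nat.lt_succ_self _
      · have := (v j).isLt
        simp only [Option.elim]
        omega
    · obtain ⟨i, hi⟩ := l.proper
      exact List.mem_map.2 ⟨i, by simp, by simp [hi]⟩
  · intro f hfm hf
    have hlt : ∀ j : Fin m, f[j.val] < a := fun j => hf.lt_of_mem (List.getElem_mem _)
    rw [← hc fun j => ⟨f[j.val], hlt j⟩, List.map_flatMap]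
    congr 2
    funext j
    rw [List.map_map]
    refine List.map_congr_left fun i _ => ?_
    rw [Function.comp_apply, Combinatorics.Line.coe_apply]
    rcases l.idxFun i with _ | v
    · simp only [Option.elim, Option.getD]
      rw [fill_add, List.getD_eq_getElem]
    · exact fill_of_lt _ (v j).isLt

/-- Over the empty alphabet every `(k + 1)`-parameter word begins with its first parameter, which
may be regarded as a letter. -/
theorem GrahamRothschild.zero_succ {k : ℕ} (h : GrahamRothschild 1 k) :
    GrahamRothschild 0 (k + 1) := by
  intro κ _ m
  rcases m with _ | m
  · refine ⟨0, fun χ => ⟨[], rfl, .nil _, χ [], fun f _ _ => rfl⟩⟩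
  obtain ⟨n, hn⟩ := h κ m
  refine ⟨n + 1, fun χ => ?_⟩
  obtain ⟨w, hwn, hw, c, hc⟩ := hn fun l => χ (0 :: l)
  refine ⟨0 :: w, by simp [hwn], .new (by rwa [show 0 + (m + 1) = 0 + 1 + m by omega]), c, ?_⟩
  intro f hfm hf
  cases hf with
  | old hx _ => omega
  | @new _ _ g hg =>
    rw [← hc g (by simpa using hfm) (by rwa [show 1 + k = 0 + (k + 1) by omega])]
    have hgm : g.length = m := by simpa using hfm
    rw [List.map_cons]
    congr 2
    refine List.map_congr_left fun s hs => ?_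
    have hs := hw.lt_of_mem hs
    rcases s with _ | s
    · rfl
    · have hsg : s < g.length := by omega
      simp [fill, hsg]

/-- Substitution of `s :: f` into `a :: y` can be carried out by treating `a` as a letter first:
`f` is rewritten over the alphabet with the additional letter `a`, and in the result `a` is replaced
by `s`. -/
theorem map_fill_cons {a s : ℕ} {y f : List ℕ} (hs : s < a)
    (hy : ∀ x ∈ y, x < a + 1 + f.length) :
    y.map (fill a (s :: f)) =
      (y.map (fill (a + 1) (f.map fun x => if x < a then x else x + 1))).map
        fun x => if x < a then x else if x = a then s else x - 1 := by
  rw [List.map_map]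
  refine List.map_congr_left fun x hx => ?_
  have hxy := hy x hx
  rw [Function.comp_apply]
  rcases lt_trichotomy x a with h | rfl | h
  · rw [fill_of_lt _ h, fill_of_lt _ (by omega), if_pos h]
  · rw [fill_of_lt _ (Nat.lt_succ_self x)]
    simp [fill]
  · obtain ⟨j, rfl⟩ := Nat.exists_eq_add_of_le (Nat.succ_le_of_lt h)
    have hj : j < f.length := by omega
    rw [Nat.succ_eq_add_one, fill_add, show a + 1 + j = a + (j + 1) by omega, fill_add,
      List.getD_cons_succ, List.getD_eq_getElem _ _ hj,
      List.getD_eq_getElem _ _ (by simpa using hj), List.getElem_map]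
    split_ifs <;> omega

theorem map_fill_cons_self {a : ℕ} {y g : List ℕ} (hy : ∀ x ∈ y, x < a + 1 + g.length) :
    y.map (fill a (a :: g)) = y.map (fill (a + 1) g) := by
  refine List.map_congr_left fun x hx => ?_
  have hxy := hy x hx
  rcases lt_trichotomy x a with h | rfl | h
  · rw [fill_of_lt _ h, fill_of_lt _ (by omega)]
  · rw [fill_of_lt _ (Nat.lt_succ_self x)]
    simp [fill]
  · obtain ⟨j, rfl⟩ := Nat.exists_eq_add_of_le (Nat.succ_le_of_lt h)
    have hj : j < g.length := by omega
    rw [Nat.succ_eq_add_one, fill_add, show a + 1 + j = a + (j + 1) by omega, fill_add,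
      List.getD_cons_succ, List.getD_eq_getElem _ _ hj, List.getD_eq_getElem _ _ hj]

/-- First half of the induction step: within a suitable `M`-parameter word the colour of a
`(k + 1)`-parameter word depends only on the prefix before its first parameter. The word is built
from the front. Its first letter is the parameter `a`. Words `f` beginning with `a` are handled by
`GrahamRothschild (a + 1) k`, those beginning with a letter `s < a` by the induction hypothesis over
the larger alphabet, applied to the tuple of the colours for all `s`. -/
theorem exists_colour_eq_of_pre_eq {k : ℕ} (hGR : ∀ a, GrahamRothschild a k) (M : ℕ) :
    ∀ (a : ℕ) (κ : Type) [Finite κ], ∃ n, ∀ χ : List ℕ → κ, ∃ w, w.length = n ∧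
      IsGrowthWord a (a + M) w ∧ ∀ f f' : List ℕ, f.length = M → f'.length = M →
        IsGrowthWord a (a + (k + 1)) f → IsGrowthWord a (a + (k + 1)) f' → pre a f = pre a f' →
          χ (w.map (fill a f)) = χ (w.map (fill a f')) := by
  induction M with
  | zero => exact fun a κ _ => ⟨0, fun χ => ⟨[], rfl, .nil _, fun f f' _ _ _ _ _ => rfl⟩⟩
  | succ M ih =>
    intro a κ _
    obtain ⟨m, hm⟩ := ih (a + 1) (Fin a → κ)
    obtain ⟨n, hn⟩ := hGR (a + 1) κ m
    refine ⟨n + 1, fun χ => ?_⟩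
    obtain ⟨v, hvn, hv, c, hc⟩ := hn fun l => χ (a :: l)
    obtain ⟨u, hum, hu, hχu⟩ := hm fun h s =>
      χ (s :: (v.map (fill (a + 1) h)).map
        fun x => if x < a then x else if x = a then (s : ℕ) else x - 1)
    subst hum
    have hvu : IsGrowthWord (a + 1) (a + 1 + M) (v.map (fill (a + 1) u)) := hv.map_fill hu
    refine ⟨a :: v.map (fill (a + 1) u), by simp [hvn],
      .new (by rwa [show a + (M + 1) = a + 1 + M by omega]), fun f f' hf hf' hfg hfg' hpre => ?_⟩
    have haa : ∀ x g, fill a (x :: g) a = x := fun x g => by simp [fill]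
    -- The colour is `c` for every word that begins with the parameter `a`.
    have hnew : ∀ g : List ℕ, g.length = M → IsGrowthWord (a + 1) (a + (k + 1)) g →
        χ ((a :: v.map (fill (a + 1) u)).map (fill a (a :: g))) = c := by
      intro g hgM hg
      rw [List.map_cons, haa, map_fill_cons_self fun x hx => hgM ▸ hvu.lt_of_mem hx,
        ← map_fill_map_fill hv]
      refine hc _ (by simp) ?_
      rw [show a + 1 + k = a + (k + 1) by omega]
      subst hgM
      exact hu.map_fill hg
    -- Words that begin with a letter `s < a` have the colours controlled by `u`.
    have hold : ∀ (s : ℕ) (g : List ℕ), s < a → g.length = M →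
        (a :: v.map (fill (a + 1) u)).map (fill a (s :: g)) = s :: (v.map (fill (a + 1)
          (u.map (fill (a + 1) (g.map fun x => if x < a then x else x + 1))))).map
            fun x => if x < a then x else if x = a then s else x - 1 := by
      intro s g hs hgM
      rw [List.map_cons, haa, map_fill_cons hs fun x hx => hgM ▸ hvu.lt_of_mem hx,
        map_fill_map_fill hv]
    have hshift : ∀ g : List ℕ, IsGrowthWord a (a + (k + 1)) g → IsGrowthWord (a + 1)
        (a + 1 + (k + 1)) (g.map fun x => if x < a then x else x + 1) := by
      intro g hg
      rw [show a + 1 + (k + 1) = a + (k + 1) + 1 by omega]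
      exact hg.map_succ_of_le le_rfl
    have hpreshift : ∀ g : List ℕ, pre (a + 1) (g.map fun x => if x < a then x else x + 1) =
        (pre a g).map fun x => if x < a then x else x + 1 := by
      intro g
      rw [pre, List.takeWhile_map, pre]
      congr 2
      funext x
      simp only [Function.comp_apply]
      split_ifs <;> simp
      omega
    cases hfg with
    | @old _ _ s g hs hg =>
      cases hfg' with
      | @old _ _ s' g' hs' hg' =>
        rw [pre_cons_of_lt _ hs, pre_cons_of_lt _ hs'] at hpre
        obtain ⟨rfl, hpre'⟩ := List.cons.inj hpre
        have hgM : g.length = M := by simpa using hf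
        have hgM' : g'.length = M := by simpa using hf'
        rw [hold s g hs hgM, hold s g' hs hgM']
        exact congrFun (hχu _ _ (by simpa using hgM) (by simpa using hgM') (hshift g hg)
          (hshift g' hg') (by rw [hpreshift, hpreshift, hpre'])) ⟨s, hs⟩
      | @new _ _ g' hg' =>
        rw [pre_cons_of_lt _ hs, pre_cons_of_le _ le_rfl] at hpre
        simp at hpre
    | @new _ _ g hg =>
      cases hfg' with
      | @old _ _ s' g' hs' hg' =>
        rw [pre_cons_of_lt _ hs', pre_cons_of_le _ le_rfl] at hpre
        simp at hpre
      | @new _ _ g' hg' =>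
        rw [hnew g (by simpa using hf) hg, hnew g' (by simpa using hf') hg']

/-- Colourings of prefixes. The word is extended at its end. After restriction to a
subspace, all words over the alphabet of the current length have a single colour `q₀`; a further
parameter may be appended to the word constructed for the colour `q₀`, while the words for the other
colours receive the letter `0`. The sum of the numbers of parameters grows with each step. -/
theorem exists_sum_le_of_pre_colouring {a : ℕ} (ha : 0 < a) (κ : Type) [Fintype κ] (M : ℕ) :
    ∃ n, ∀ χ : List ℕ → κ, ∃ t : κ → ℕ, M ≤ ∑ q, t q ∧ ∀ q, ∀ j ≤ t q, ∃ v, v.length = n ∧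
      IsGrowthWord a (a + j) v ∧ ∀ f : List ℕ, f.length = j → (∃ x ∈ f, a ≤ x) →
        χ (pre a (v.map (fill a f))) = q := by
  classical
  induction M with
  | zero =>
    refine ⟨0, fun χ => ⟨0, by simp, fun q j hj => ?_⟩⟩
    obtain rfl : j = 0 := by simpa using hj
    refine ⟨[], rfl, .nil _, fun f hf hfa => ?_⟩
    rw [List.eq_nil_of_length_eq_zero hf] at hfa
    simp at hfa
  | succ M ih =>
    obtain ⟨n, hn⟩ := ih
    obtain ⟨L, hL⟩ := grahamRothschild_zero a κ n
    refine ⟨L + 1, fun χ => ?_⟩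
    obtain ⟨V, hVL, hV, q₀, hq₀⟩ := hL χ
    obtain ⟨t, htM, ht⟩ := hn fun β => χ (pre a (V.map (fill a β)))
    -- A word of the previous stage, carried into `V` and followed by one more symbol.
    have hext : ∀ {j : ℕ} {v f : List ℕ} {q : κ} (y : List ℕ), v.length = n →
        IsGrowthWord a (a + j) v → f.length = j → (∃ x ∈ f, a ≤ x) →
        (∀ f : List ℕ, f.length = j → (∃ x ∈ f, a ≤ x) →
          χ (pre a (V.map (fill a (pre a (v.map (fill a f)))))) = q) →
        χ (pre a (((V.map (fill a v)).map (fill a f)) ++ y)) = q := by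
      intro j v f q y hvn hv hfj hf hq
      subst hvn
      rw [← hq f hfj hf, pre_append_of_exists, ← map_fill_map_fill hV, pre_map_fill_pre hV]
      exact exists_le_mem_map_fill (hV.map_fill hv) hfj hf
    refine ⟨Function.update t q₀ (t q₀ + 1), ?_, fun q j hj => ?_⟩
    · rw [Finset.sum_update_of_mem (Finset.mem_univ _)]
      rw [← Finset.add_sum_erase _ _ (Finset.mem_univ q₀), ← Finset.sdiff_singleton_eq_erase] at htM
      omega
    by_cases hjt : j ≤ t q
    · obtain ⟨v, hvn, hv, hvq⟩ := ht q j hjt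
      subst hvn
      refine ⟨V.map (fill a v) ++ [0], by simp [hVL], (hV.map_fill hv).append
        (.of_forall_lt (by simp; omega)), fun f hfj hf => ?_⟩
      rw [List.map_append]
      exact hext _ rfl hv hfj hf hvq
    · obtain rfl : q = q₀ := by
        by_contra hne
        rw [Function.update_of_ne hne] at hj
        exact hjt hj
      rw [Function.update_self] at hj
      obtain rfl : j = t q + 1 := by omega
      obtain ⟨v, hvn, hv, hvq⟩ := ht q (t q) le_rfl
      subst hvn
      refine ⟨V.map (fill a v) ++ [a + t q], by simp [hVL],
        (hV.map_fill hv).append (.new (.nil _)), fun f hfj hf => ?_⟩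
      obtain ⟨g, x, rfl⟩ : ∃ g x, f = g ++ [x] :=
        ⟨f.dropLast, f.getLast (by rintro rfl; simp at hfj),
          (List.dropLast_append_getLast _).symm⟩
      have hgt : g.length = t q := by simpa using hfj
      have hcongr : (V.map (fill a v)).map (fill a (g ++ [x])) =
          (V.map (fill a v)).map (fill a g) := by
        refine List.map_congr_left fun s hs => ?_
        have hst := (hV.map_fill hv).lt_of_mem hs
        by_cases hsa : s < a
        · rw [fill_of_lt _ hsa, fill_of_lt _ hsa]
        · obtain ⟨i, rfl⟩ := Nat.exists_eq_add_of_le (not_lt.1 hsa)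
          rw [fill_add, fill_add, List.getD_append _ _ _ _ (by omega)]
      have hlast : fill a (g ++ [x]) (a + t q) = x := by
        rw [fill_add, ← hgt]; simp [List.getD_eq_getElem?_getD]
      rw [List.map_append, hcongr, List.map_singleton, hlast]
      by_cases hg : ∃ x ∈ g, a ≤ x
      · exact hext _ rfl hv hgt hg hvq
      · push Not at hg
        have hxa : a ≤ x := by
          obtain ⟨z, hz, haz⟩ := hf
          rcases List.mem_append.1 hz with hz | hz
          · exact absurd (hg z hz) (by omega)
          · rwa [← List.mem_singleton.1 hz]
        have hvg : IsGrowthWord a a (v.map (fill a g)) := by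
          rw [← hgt] at hv
          exact hv.map_fill (.of_forall_lt hg)
        rw [← map_fill_map_fill hV, pre_append_of_forall, pre_cons_of_le _ hxa, List.append_nil]
        · exact hq₀ _ (by simp) hvg
        · have hV' : IsGrowthWord a (a + (v.map (fill a g)).length) V := by simpa using hV
          exact fun z hz => (hV'.map_fill hvg).lt_of_mem hz

/-- Second half of the induction step: a colouring of prefixes is constant on a suitable
`m`-parameter word, by the pigeonhole principle. -/
theorem exists_pre_colouring_const {a : ℕ} (ha : 0 < a) (κ : Type) [Finite κ] (m : ℕ) :
    ∃ n, ∀ χ : List ℕ → κ, ∃ v, v.length = n ∧ IsGrowthWord a (a + m) v ∧ ∃ q,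
      ∀ f : List ℕ, f.length = m → (∃ x ∈ f, a ≤ x) → χ (pre a (v.map (fill a f))) = q := by
  have := Fintype.ofFinite κ
  obtain ⟨n, hn⟩ := exists_sum_le_of_pre_colouring ha κ (Fintype.card κ * m)
  refine ⟨n, fun χ => ?_⟩
  obtain ⟨t, htm, ht⟩ := hn χ
  obtain ⟨q, -, hq⟩ : ∃ q ∈ Finset.univ, m ≤ t q :=
    Finset.exists_le_of_sum_le ⟨χ [], Finset.mem_univ _⟩ (by simpa using htm)
  obtain ⟨v, hvn, hv, hvq⟩ := ht q m hq
  exact ⟨v, hvn, hv, q, hvq⟩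

theorem GrahamRothschild.succ {a k : ℕ} (ha : 0 < a) (h : ∀ a, GrahamRothschild a k) :
    GrahamRothschild a (k + 1) := by
  intro κ _ m
  obtain ⟨M, hM⟩ := exists_pre_colouring_const ha κ m
  obtain ⟨n, hn⟩ := exists_colour_eq_of_pre_eq h M a κ
  refine ⟨n, fun χ => ?_⟩
  obtain ⟨w, hwn, hw, hχ⟩ := hn χ
  -- On prefixes of words of length `M` the colouring `χ` factors through the prefix.
  obtain ⟨c, hc⟩ : ∃ c : List ℕ → κ, ∀ f : List ℕ, f.length = M →
      IsGrowthWord a (a + (k + 1)) f → c (pre a f) = χ (w.map (fill a f)) := by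
    classical
    refine ⟨fun β => if hβ : ∃ f : List ℕ, f.length = M ∧ IsGrowthWord a (a + (k + 1)) f ∧
      pre a f = β then χ (w.map (fill a hβ.choose)) else χ [], fun f hfM hf => ?_⟩
    have hβ : ∃ f' : List ℕ, f'.length = M ∧ IsGrowthWord a (a + (k + 1)) f' ∧
      pre a f' = pre a f := ⟨f, hfM, hf, rfl⟩
    simp only [dif_pos hβ]
    exact hχ _ _ hβ.choose_spec.1 hfM hβ.choose_spec.2.1 hf hβ.choose_spec.2.2
  obtain ⟨v, hvM, hv, q, hq⟩ := hM c
  subst hvM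
  refine ⟨w.map (fill a v), by simpa using hwn, hw.map_fill hv, q, fun f hfm hf => ?_⟩
  rw [← hq f hfm ⟨a, hf.mem le_rfl (by omega), le_rfl⟩, ← map_fill_map_fill hw]
  subst hfm
  exact (hc _ (by simp) (hv.map_fill hf)).symm

/-- The **Graham–Rothschild theorem**. -/
theorem grahamRothschild (k : ℕ) : ∀ a, GrahamRothschild a k := by
  induction k with
  | zero => exact grahamRothschild_zero
  | succ k ih =>
    intro a
    rcases a.eq_zero_or_pos with rfl | ha
    · exact (ih 1).zero_succ
    · exact .succ ha ih

/-! ### Surjections onto finite sets -/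

/-- Numbering letters by first occurrence: a word over any alphabet `α` is the image of a growth
word under an enumeration of its letters. The list `σ` holds the letters enumerated beforehand. -/
theorem exists_growthWord_map_eq {α : Type*} (L : List α) (σ : List α) (hσ : σ.Nodup) :
    ∃ (l : List ℕ) (τ : List α), (σ ++ τ).Nodup ∧
      IsGrowthWord σ.length (σ ++ τ).length l ∧ l.map (fun i => (σ ++ τ)[i]?) = L.map some := by
  classical
  induction L generalizing σ with
  | nil => exact ⟨[], [], by simpa using hσ, by simpa using IsGrowthWord.nil _, rfl⟩
  | cons x L ih =>
    by_cases hx : x ∈ σ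
    · obtain ⟨l, τ, hτ, hl, hlL⟩ := ih σ hσ
      obtain ⟨i, hi, rfl⟩ := List.mem_iff_getElem.1 hx
      refine ⟨i :: l, τ, hτ, .old hi hl, ?_⟩
      rw [List.map_cons, hlL, List.map_cons, List.getElem?_append_left hi,
        List.getElem?_eq_getElem hi]
    · obtain ⟨l, τ, hτ, hl, hlL⟩ := ih (σ ++ [x]) (by
        rw [← List.concat_eq_append, List.nodup_concat]; exact ⟨hx, hσ⟩)
      have happ : σ ++ x :: τ = (σ ++ [x]) ++ τ := by simp
      refine ⟨σ.length :: l, x :: τ, by rwa [happ], .new ?_, ?_⟩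
      · rwa [happ, show σ.length + 1 = (σ ++ [x]).length by simp]
      · rw [happ, List.map_cons, hlL]; simp

/-- A surjection from `{0, …, m - 1}` onto `{0, …, n - 1}` is a growth word followed by a
permutation. -/
theorem exists_growthWord_perm {m n : ℕ} {f : Fin m → Fin n} (hf : Function.Surjective f) :
    ∃ (l : List ℕ) (π : Equiv.Perm (Fin n)), l.length = m ∧ IsGrowthWord 0 n l ∧
      ∀ (i : Fin m) (j : Fin n), l[i.val]? = some j.val → π j = f i := by
  obtain ⟨l, τ, hτ, hl, hlL⟩ := exists_growthWord_map_eq (List.ofFn f) [] List.nodup_nil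
  rw [List.nil_append] at hτ hl hlL
  have hlm : l.length = m := by simpa using congrArg List.length hlL
  have hget : ∀ (i : Fin m) (j : ℕ), l[i.val]? = some j → τ[j]? = some (f i) := by
    intro i j hij
    have := congrArg (fun L => L[i.val]?) hlL
    simpa [hij] using this
  have hmem : ∀ y, y ∈ τ := by
    intro y
    obtain ⟨i, rfl⟩ := hf y
    have hi : i.val < l.length := hlm ▸ i.isLt
    exact List.mem_of_getElem? (hget i _ (List.getElem?_eq_getElem hi))
  have hτn : τ.length = n := by
    have := Fintype.card_congr (hτ.getEquivOfForallMemList τ hmem)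
    simpa using this
  let π : Equiv.Perm (Fin n) := (finCongr hτn.symm).trans (hτ.getEquivOfForallMemList τ hmem)
  refine ⟨l, π, hlm, hτn ▸ hl, fun i j hij => ?_⟩
  have h := hget i j hij
  have hj : j.val < τ.length := hτn.symm ▸ j.isLt
  rw [List.getElem?_eq_getElem hj] at h
  exact Option.some.inj h

/-- The finite dual Ramsey theorem for surjections, not necessarily rigid ones: if the surjections
from `{0, …, N - 1}` onto `{0, …, n - 1}` are coloured, then some surjection `w` onto
`{0, …, m - 1}` leaves at most one colour for every permutation of `{0, …, n - 1}`. Here the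
colouring `χ` is defined on all maps. -/
theorem exists_dualRamsey_surjection (κ : Type) [Finite κ] [Nonempty κ] (m n : ℕ) :
    ∃ N, ∀ χ : (Fin N → Fin n) → κ, ∃ w : Fin N → Fin m, Function.Surjective w ∧
      ∃ c : Equiv.Perm (Fin n) → κ, ∀ f : Fin m → Fin n, Function.Surjective f →
        ∃ π, χ (f ∘ w) = c π := by
  classical
  obtain ⟨N, hN⟩ := grahamRothschild n 0 (Equiv.Perm (Fin n) → κ) m
  refine ⟨N, fun χ => ?_⟩
  -- The word `l` represents the map `i ↦ l[i]`; its colour is the tuple of the colours of all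
  -- maps obtained from it by a permutation. Lists that represent no map receive an arbitrary colour.
  obtain ⟨w, hwN, hw, c, hc⟩ := hN fun l π =>
    if h : ∀ i : Fin N, l.getD i n < n then χ fun i => π ⟨l.getD i n, h i⟩
    else Classical.arbitrary κ
  subst hwN
  rw [zero_add] at hw
  refine ⟨fun i => ⟨w[i.val], hw.lt_of_mem (List.getElem_mem _)⟩, fun y => ?_, c, fun f hf => ?_⟩
  · obtain ⟨i, hi, hiy⟩ := List.mem_iff_getElem.1 (hw.mem (Nat.zero_le _) y.isLt)
    exact ⟨⟨i, hi⟩, Fin.ext hiy⟩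
  · obtain ⟨l, π, hlm, hl, hπ⟩ := exists_growthWord_perm hf
    refine ⟨π, ?_⟩
    rw [← hc l hlm (by rwa [zero_add])]
    have hwl : ∀ i : Fin w.length, w[i.val] < l.length := fun i => by
      rw [hlm]; exact hw.lt_of_mem (List.getElem_mem _)
    have hget : ∀ i : Fin w.length, (w.map (fill 0 l)).getD i n = l[w[i.val]]'(hwl i) := by
      intro i
      rw [List.getD_eq_getElem _ _ (by simp), List.getElem_map]
      exact List.getD_eq_getElem _ _ (hwl i)
    have hlt : ∀ i : Fin w.length, (w.map (fill 0 l)).getD i n < n := fun i =>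
      (hget i).trans_lt (hl.lt_of_mem (List.getElem_mem _))
    simp only [dif_pos hlt]
    congr 1
    funext i
    refine (hπ ⟨w[i.val], hlm ▸ hwl i⟩ _ ?_).symm
    rw [List.getElem?_eq_getElem (hwl i)]
    exact congrArg some (hget i).symm

end DualRamsey

namespace RamseyDegree

/-! ### Equilateral spaces -/

namespace FinMet

/-- The finite metric space on `α` in which distinct points have distance `R`. -/
noncomputable def equilateral (α : Type u) [Finite α] (R : ℝ) (hR : 0 < R) : FinMet.{u} :=
  open scoped Classical in
  { carrier := α
    metric :=
      { dist := fun x y => if x = y then 0 else R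
        dist_self := fun x => if_pos rfl
        dist_comm := fun x y => if_congr eq_comm rfl rfl
        dist_triangle := fun x y z => by
          split_ifs <;> first | linarith | simp_all
        eq_of_dist_eq_zero := fun {x y} h => by
          by_contra hne
          exact hR.ne' (by simpa [hne] using h) }
    fin := ‹_› }

/-- Every surjection from an equilateral space with sufficiently large distances is
non-expansive. -/
noncomputable def ofSurjective {α : Type u} [Finite α] {R : ℝ} (hR : 0 < R) {M : FinMet.{u}}
    (hM : ∀ x y : M.carrier, dist x y ≤ R) (f : α → M.carrier) (hf : Function.Surjective f) :
    equilateral α R hR ⟶ M where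
  toFun := f
  nonexpansive x y := by
    by_cases h : x = y
    · subst h; rw [dist_self, dist_self]
    · refine (hM _ _).trans (le_of_eq ?_)
      exact (if_neg h).symm
  surjective := hf

theorem exists_dist_le (M : FinMet.{u}) : ∃ R : ℝ, 0 < R ∧ ∀ x y : M.carrier, dist x y ≤ R := by
  obtain ⟨R, hR⟩ := (Set.finite_range fun p : M.carrier × M.carrier => dist p.1 p.2).bddAbove
  exact ⟨max R 1, by positivity, fun x y => (hR ⟨(x, y), rfl⟩).trans (le_max_left _ _)⟩

theorem dist_le_of_hom {B M : FinMet.{u}} (g : B ⟶ M) {R : ℝ}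
    (hR : ∀ x y : B.carrier, dist x y ≤ R) (x y : M.carrier) : dist x y ≤ R := by
  obtain ⟨x, rfl⟩ := g.surjective x
  obtain ⟨y, rfl⟩ := g.surjective y
  exact (g.nonexpansive x y).trans (hR x y)

/-! ### The dual small Ramsey degree -/

theorem isSmallRamseyBound_factorial (M : FinMet.{u}) :
    IsSmallRamseyBound (Opposite.op M) (Nat.card M.carrier).factorial := by
  classical
  rintro k ⟨B⟩ ⟨g⟩
  obtain ⟨R, hR, hB⟩ := B.exists_dist_le
  have hM := dist_le_of_hom g.unop hB
  let n := Nat.card M.carrier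
  let eB : B.carrier ≃ Fin (Nat.card B.carrier) := Finite.equivFin _
  let eM : M.carrier ≃ Fin n := Finite.equivFin _
  obtain ⟨N, hN⟩ :=
    DualRamsey.exists_dualRamsey_surjection (Option (Fin k)) (Nat.card B.carrier) n
  have hNB : ∀ w : Fin N → Fin (Nat.card B.carrier), Function.Surjective w →
      Function.Surjective fun i : ULift.{u} (Fin N) => eB.symm (w i.down) := fun w hw =>
    eB.symm.surjective.comp (hw.comp ULift.down_surjective)
  refine ⟨Opposite.op (equilateral (ULift.{u} (Fin N)) R hR), ?_, fun χ => ?_⟩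
  · obtain ⟨w, hw, -⟩ := hN fun _ => none
    exact ⟨(ofSurjective hR hB _ (hNB w hw)).op⟩
  -- Maps that are not surjective receive the extra colour `none`.
  obtain ⟨w, hw, c, hc⟩ := hN fun h =>
    if hh : Function.Surjective fun i : ULift.{u} (Fin N) => eM.symm (h i.down) then
      some (χ (ofSurjective hR hM _ hh).op) else none
  refine ⟨(ofSurjective hR hB _ (hNB w hw)).op, ?_⟩
  have hsub : some '' (χ '' Set.range fun f : Opposite.op M ⟶ Opposite.op B =>
      f ≫ (ofSurjective hR hB _ (hNB w hw)).op) ⊆ Set.range c := by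
    rintro _ ⟨_, ⟨_, ⟨f, rfl⟩, rfl⟩, rfl⟩
    obtain ⟨π, hπ⟩ := hc (fun i => eM (f.unop.toFun (eB.symm i)))
      (eM.surjective.comp (f.unop.surjective.comp eB.symm.surjective))
    refine ⟨π, hπ.symm.trans ?_⟩
    have hcomp : (fun i : ULift.{u} (Fin N) => eM.symm
        (((fun i => eM (f.unop.toFun (eB.symm i))) ∘ w) i.down)) =
          (ofSurjective hR hB _ (hNB w hw) ≫ f.unop).toFun := by
      funext i
      exact eM.symm_apply_apply _
    rw [dif_pos (hcomp ▸ (ofSurjective hR hB _ (hNB w hw) ≫ f.unop).surjective)]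
    congr 2
    apply Quiver.Hom.unop_inj
    exact Hom.ext hcomp
  rw [← Set.ncard_image_of_injective _ (Option.some_injective _)]
  refine (Set.ncard_le_ncard hsub (Set.toFinite _)).trans ?_
  rw [← Set.image_univ]
  refine (Set.ncard_image_le Set.finite_univ).trans (le_of_eq ?_)
  rw [Set.ncard_univ, Nat.card_perm, Nat.card_eq_fintype_card, Fintype.card_fin]

/-- The permutations of `M` act on the maps `D → M`, freely on surjections. The colour of a map is
a permutation that carries a chosen representative of its orbit to it, so distinct permutations
after one surjection `w` have distinct colours. Equilateral `B` on the points of `M` makes every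
permutation a morphism `B ⟶ M`. -/
theorem factorial_le_of_isSmallRamseyBound (M : FinMet.{u}) {t : ℕ}
    (h : IsSmallRamseyBound (Opposite.op M) t) : (Nat.card M.carrier).factorial ≤ t := by
  obtain ⟨R, hR, hM⟩ := M.exists_dist_le
  have hcard : Nat.card (Equiv.Perm M.carrier) = (Nat.card M.carrier).factorial := Nat.card_perm
  let e : Equiv.Perm M.carrier ≃ Fin (Nat.card (Equiv.Perm M.carrier)) := Finite.equivFin _
  let ρ : Equiv.Perm M.carrier → (equilateral M.carrier R hR ⟶ M) := fun π =>
    ofSurjective hR hM π π.surjective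
  obtain ⟨⟨D⟩, -, hD⟩ := h (Nat.card (Equiv.Perm M.carrier))
    (Opposite.op (equilateral M.carrier R hR)) ⟨(ρ 1).op⟩
  let S := MulAction.orbitRel (Equiv.Perm M.carrier) (D.carrier → M.carrier)
  have hrep : ∀ g : D.carrier → M.carrier, ∃ π : Equiv.Perm M.carrier,
      π • (Quotient.mk S g).out = g := fun g =>
    MulAction.orbitRel_apply.1 (Setoid.symm' S (Quotient.mk_out (s := S) g))
  choose col hcol using hrep
  obtain ⟨w, hw⟩ := hD fun g => e (col g.unop.toFun)
  let w' : D.carrier → M.carrier := w.unop.toFun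
  have hinj : Function.Injective fun π : Equiv.Perm M.carrier => e (col (π • w')) := by
    intro π π' hππ'
    have hcc : col (π • w') = col (π' • w') := e.injective hππ'
    have hmk : Quotient.mk S (π • w') = Quotient.mk S (π' • w') :=
      Quotient.sound (s := S) (MulAction.orbitRel_apply.2 ⟨π * π'⁻¹, by simp [mul_smul]⟩)
    have heq : π • w' = π' • w' := by rw [← hcol (π • w'), ← hcol (π' • w'), hcc, hmk]
    ext y
    obtain ⟨x, rfl⟩ := w.unop.surjective y
    exact congrFun heq x
  rw [← hcard, ← Set.ncard_univ, ← Set.ncard_image_of_injective _ hinj]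
  refine (Set.ncard_le_ncard ?_ (Set.toFinite _)).trans hw
  rintro _ ⟨π, -, rfl⟩
  exact ⟨_, ⟨(ρ π).op, rfl⟩, rfl⟩

theorem dualSmallRamseyDegree_eq_factorial (M : FinMet.{u}) :
    dualSmallRamseyDegree M = ((Nat.card M.carrier).factorial : ℕ∞) := by
  refine le_antisymm
    (sInf_le ⟨_, Nat.factorial_pos _, isSmallRamseyBound_factorial M, rfl⟩) (le_sInf ?_)
  rintro _ ⟨t, -, ht, rfl⟩
  exact_mod_cast factorial_le_of_isSmallRamseyBound M ht

end FinMet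

end RamseyDegree

theorem mainTheorem1 :
    RamseyDegree.HasFiniteDualSmallRamseyDegrees RamseyDegree.FinMet.{u} ∧
      ∀ M : RamseyDegree.FinMet.{u},
        RamseyDegree.dualSmallRamseyDegree M = ((Nat.card M.carrier).factorial : ℕ∞) := by
  refine ⟨fun X => ?_, RamseyDegree.FinMet.dualSmallRamseyDegree_eq_factorial⟩
  exact (RamseyDegree.FinMet.dualSmallRamseyDegree_eq_factorial X.unop).trans_lt
    (ENat.natCast_lt_top _)
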